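/- Let $n\in\mathbb N$ and let $M=\{(u_i,v_i)\}_{i=1}^m$ be a set of $m\ge 1$ pairs of elements of $\{0,1\}^n$ such that $u_1,v_1,\dots,u_m,v_m$ are all distinct; let $\cup M$ be the set of these $2m$ strings, and let $g:\{0,1\}^n\setminus\cup M\to\{0,1\}$ be arbitrary. Define $\varepsilon>0$ by $\varepsilon 2^n=m$. For a bipartition $M=A\sqcup B$ let $f^{(0)}_{A,B},f^{(1)}_{A,B}:\{0,1\}^n\to\{0,1\}$ both be equal to $g$ off $\cup M$, and put $$f^{(0)}_{A,B}(u)=f^{(0)}_{A,B}(v)=1,\quad f^{(1)}_{A,B}(u)=1,\ f^{(1)}_{A,B}(v)=0\qquad\text{for }(u,v)\in A,$$ $$f^{(0)}_{A,B}(u)=f^{(0)}_{A,B}(v)=0,\quad f^{(1)}_{A,B}(u)=0,\ f^{(1)}_{A,B}(v)=1\qquad\text{for }(u,v)\in B.$$ (The families $F_0=\{f^{(0)}_{A,B}\}$ and $F_1=\{f^{(1)}_{A,B}\}$ are the twin ensembles of $M$ and $g$.) For $f:\{0,1\}^n\to\{0,1\}$ let $|\Psi^{\mathrm{ph}}_f\rangle=2^{-n/2}\sum_x(-1)^{f(x)}|x\rangle$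 be its phase state and $|f\rangle=2^{-n/2}\sum_x|x,f(x)\rangle$ its function state. For $t\in\mathbb N$ and $k\in\{0,1\}$ put $$\rho^{\mathrm{ph}}_{k,t}=\mathbb E\left[\left(|\Psi^{\mathrm{ph}}_{f^{(k)}_{A,B}}\rangle\langle\Psi^{\mathrm{ph}}_{f^{(k)}_{A,B}}|\right)^{\otimes t}\right],\qquad \rho_{k,t}=\mathbb E\left[\left(|f^{(k)}_{A,B}\rangle\langle f^{(k)}_{A,B}|\right)^{\otimes t}\right],$$ where the expectations are over a uniformly random ordered bipartition $M=A\sqcup B$. Let $\|\cdot\|_1$ denote the trace norm (the sum of the singular values). **Theorem.** 1. For every $c>0$ there is $\delta=\delta(c)>0$ such that for all $n$, $M$, $g$ as above and all $t\in\mathbb N$ with $t\ge c/\varepsilon$, $$\|\rho^{\mathrm{ph}}_{0,t}-\rho^{\mathrm{ph}}_{1,t}\|_1\ge\delta\qquad\text{and}\qquad\|\rho_{0,t}-\rho_{1,t}\|_1\ge\delta .$$ 2. The twin ensembles can be distinguished from $O(1/\varepsilon)$ copies of the function state: there is an absolute constant $C>0$ such that for all $n$, $M$, $g$ as above and all $t\in\mathbb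 N$ with $t\ge C/\varepsilon$ there is a two-outcome measurement with accepting effect $0\le E\le 1$ on $t$ copies of the function state such that $\operatorname{tr}(E\rho_{0,t})\ge 2/3$ and $\operatorname{tr}(E\rho_{1,t})\le 1/3$. -/

import Mathlib

open scoped Matrix ComplexOrder

/-- The Boolean hypercube of `n`-bit strings. -/
abbrev Cube (n : ℕ) : Type := Fin n → Bool

/-! ### Twin ensembles -/

/-- The set of strings that occur in some pair of `M`. -/
def cover {n : ℕ} (M : Finset (Cube n × Cube n)) : Finset (Cube n) :=
  M.image Prod.fst ∪ M.image Prod.snd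

/-- `M = {(u₁, v₁), …, (uₘ, vₘ)}` with all of `u₁, v₁, …, uₘ, vₘ` distinct. -/
structure IsPairing {n : ℕ} (M : Finset (Cube n × Cube n)) : Prop where
  fst_inj : ∀ p ∈ M, ∀ q ∈ M, p.1 = q.1 → p = q
  snd_inj : ∀ p ∈ M, ∀ q ∈ M, p.2 = q.2 → p = q
  fst_ne_snd : ∀ p ∈ M, ∀ q ∈ M, p.1 ≠ q.2

/-- The function `f_{A,B}^{(0)}`, where `B = M \ A`: it is `1` on both elements of each pair in `A`,
`0` on both elements of each pair in `B`, and equal to `g` off the pairs. -/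
def twin0 {n : ℕ} (M : Finset (Cube n × Cube n)) (g : {x : Cube n // x ∉ cover M} → Bool)
    (A : Finset (Cube n × Cube n)) (x : Cube n) : Bool :=
  if h : x ∈ cover M then decide (∃ p ∈ A, x = p.1 ∨ x = p.2) else g ⟨x, h⟩

/-- The function `f_{A,B}^{(1)}`, where `B = M \ A`: it is `1` on `u` and `0` on `v` for each pair
`(u, v)` in `A`, `0` on `u` and `1` on `v` for each pair `(u, v)` in `B`, and equal to `g` off the
pairs. -/
def twin1 {n : ℕ} (M : Finset (Cube n × Cube n)) (g : {x : Cube n // x ∉ cover M} → Bool)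
    (A : Finset (Cube n × Cube n)) (x : Cube n) : Bool :=
  if h : x ∈ cover M then decide ((∃ p ∈ A, x = p.1) ∨ (∃ p ∈ M \ A, x = p.2)) else g ⟨x, h⟩

/-! ### Quantum states -/

/-- The phase state `2^{-n/2} ∑ₓ (-1)^{f(x)} |x⟩`, as a vector of amplitudes. -/
noncomputable def phaseState {n : ℕ} (f : Cube n → Bool) : Cube n → ℂ :=
  fun x => ((Real.sqrt (2 ^ n) : ℝ) : ℂ)⁻¹ * (-1) ^ (f x).toNat

/-- The function state `2^{-n/2} ∑ₓ |x, f(x)⟩` on `n + 1` qubits, as a vector of amplitudes. -/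
noncomputable def functionState {n : ℕ} (f : Cube n → Bool) : Cube n × Bool → ℂ :=
  fun z => ((Real.sqrt (2 ^ n) : ℝ) : ℂ)⁻¹ * (if z.2 = f z.1 then 1 else 0)

/-- The rank-one matrix `|ψ⟩⟨ψ|`. -/
def ketbra {X : Type*} (ψ : X → ℂ) : Matrix X X ℂ :=
  Matrix.vecMulVec ψ (star ψ)

/-- The `t`-fold tensor (Kronecker) power of a matrix, indexed by `t`-tuples. -/
def tensorPow {X : Type*} (t : ℕ) (P : Matrix X X ℂ) : Matrix (Fin t → X) (Fin t → X) ℂ :=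
  Matrix.of fun x y => ∏ j, P (x j) (y j)

/-- The average of `(|ψ_A⟩⟨ψ_A|)^{⊗ t}` over a uniformly random `A ⊆ M`, that is, over a uniformly
random ordered bipartition `M = A ⊔ B`. -/
noncomputable def averageState {X Y : Type*} (t : ℕ) (M : Finset Y) (ψ : Finset Y → X → ℂ) :
    Matrix (Fin t → X) (Fin t → X) ℂ :=
  ((2 : ℂ) ^ M.card)⁻¹ • ∑ A ∈ M.powerset, tensorPow t (ketbra (ψ A))

/-- The trace norm (Schatten `1`-norm) of a square complex matrix: the sum of its singular values,
which are the square roots of the eigenvalues of `Pᴴ * P`. -/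
noncomputable def traceNorm {X : Type*} [Fintype X] [DecidableEq X] (P : Matrix X X ℂ) : ℝ :=
  ∑ i, Real.sqrt ((Matrix.isHermitian_conjTranspose_mul_self P).eigenvalues i)

/-- An effect `0 ≤ E ≤ 1`, i.e. the accepting element of a two-outcome quantum measurement. -/
def IsEffect {X : Type*} [Fintype X] [DecidableEq X] (E : Matrix X X ℂ) : Prop :=
  E.PosSemidef ∧ (1 - E).PosSemidef

/-- The probability that the measurement with accepting effect `E` accepts the state `ρ`. -/
noncomputable def acceptProb {X : Type*} [Fintype X] (E ρ : Matrix X X ℂ) : ℝ :=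
  (E * ρ).trace.re

/-! ### Tensor powers -/

section TensorPow

variable {X : Type*} (t : ℕ)

/-! Swapping the two strings of every pair is an involution of the cube that leaves every `twin0`
function unchanged and flips the value of every `twin1` function exactly on the `2m` covered
strings. Let `U` be its permutation unitary (acting trivially on the value bit for function states)
and measure the projection `(1 + U) / 2` on each copy. States of the first family are fixed by `U`
and are always accepted. For the second family one copy is accepted with probability `1 - 2ε`
(phase) or `1 - ε` (function), whatever the bipartition, so averaging costs nothing and `t` copies
all pass with probability at most `exp (-ε t)`. The gap in acceptance probability bounds the trace
norm from below by `re_trace_mul_le_traceNorm`; `fixedProj_distinguishes` assembles both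
conclusions. -/

theorem trace_tensorPow [Fintype X] (P : Matrix X X ℂ) :
    (tensorPow t P).trace = P.trace ^ t := by
  simp only [Matrix.trace, Matrix.diag_apply, tensorPow, Matrix.of_apply]
  exact (Fintype.sum_pow (fun a => P a a) t).symm

theorem tensorPow_mul [Fintype X] (P Q : Matrix X X ℂ) :
    tensorPow t (P * Q) = tensorPow t P * tensorPow t Q := by
  ext x y
  simp only [Matrix.mul_apply, tensorPow, Matrix.of_apply, ← Finset.prod_mul_distrib]
  rw [Finset.prod_univ_sum, Fintype.piFinset_univ]

theorem tensorPow_isHermitian {P : Matrix X X ℂ} (hP : P.IsHermitian) :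
    (tensorPow t P).IsHermitian := by
  ext x y
  simp only [Matrix.conjTranspose_apply, tensorPow, Matrix.of_apply, star_prod, hP.apply]

end TensorPow

/-! ### Orthogonal projections as effects, and the trace norm -/

section Projection

variable {X : Type*} [Fintype X]

theorem conjTranspose_mul_self_apply_self (A : Matrix X X ℂ) (i : X) :
    ((Aᴴ * A) i i).re = ∑ k, ‖A k i‖ ^ 2 := by
  simp only [Matrix.mul_apply, Matrix.conjTranspose_apply, Complex.re_sum]
  refine Finset.sum_congr rfl fun k _ => ?_
  rw [Complex.star_def, mul_comm, Complex.mul_conj, Complex.ofReal_re, Complex.normSq_eq_norm_sq]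

/-- Cauchy–Schwarz for the `i`-th columns of `A` and `B`. -/
theorem norm_conjTranspose_mul_apply_self_le (A B : Matrix X X ℂ) (i : X) :
    ‖(Aᴴ * B) i i‖ ≤ Real.sqrt ((Aᴴ * A) i i).re * Real.sqrt ((Bᴴ * B) i i).re := by
  rw [conjTranspose_mul_self_apply_self, conjTranspose_mul_self_apply_self]
  calc ‖(Aᴴ * B) i i‖ ≤ ∑ k, ‖A k i‖ * ‖B k i‖ := by
        rw [Matrix.mul_apply]
        refine (norm_sum_le _ _).trans_eq (Finset.sum_congr rfl fun k _ => ?_)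
        simp
    _ ≤ _ := Real.sum_mul_le_sqrt_mul_sqrt _ _ _

variable [DecidableEq X] {E : Matrix X X ℂ}

theorem isEffect_of_isHermitian_of_mul_self (hE : E.IsHermitian) (hE2 : E * E = E) :
    IsEffect E := by
  constructor
  · have h := Matrix.posSemidef_conjTranspose_mul_self E
    rwa [hE.eq, hE2] at h
  · have h := Matrix.posSemidef_conjTranspose_mul_self (1 - E)
    have h1 : (1 - E)ᴴ * (1 - E) = 1 - E := by
      rw [Matrix.conjTranspose_sub, Matrix.conjTranspose_one, hE.eq]
      simp [mul_sub, sub_mul, hE2]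
    rwa [h1] at h

/-- A projective measurement distinguishes no better than the trace norm allows. -/
theorem re_trace_mul_le_traceNorm (hE : E.IsHermitian) (hE2 : E * E = E) (D : Matrix X X ℂ) :
    (E * D).trace.re ≤ traceNorm D := by
  set hD := Matrix.isHermitian_conjTranspose_mul_self D
  set V : Matrix X X ℂ := (hD.eigenvectorUnitary : Matrix X X ℂ) with hV
  have hVV : V * Vᴴ = 1 := Unitary.coe_mul_star_self hD.eigenvectorUnitary
  have hVV' : Vᴴ * V = 1 := Unitary.coe_star_mul_self hD.eigenvectorUnitary
  -- In an orthonormal eigenbasis `v i` of `Dᴴ * D`, the trace is `∑ i, ⟪E v i, D v i⟫`, where `‖D v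
  -- i‖` is the `i`-th singular value.
  have htr : (E * D).trace = ((E * V)ᴴ * (D * V)).trace := by
    rw [Matrix.conjTranspose_mul, hE.eq, Matrix.mul_assoc, ← Matrix.mul_assoc E,
      Matrix.trace_mul_comm Vᴴ, Matrix.mul_assoc, hVV, Matrix.mul_one]
  have hspec : (D * V)ᴴ * (D * V) = Matrix.diagonal (RCLike.ofReal ∘ hD.eigenvalues) := by
    rw [← hD.conjStarAlgAut_star_eigenvectorUnitary, Unitary.conjStarAlgAut_star_apply,
      Matrix.conjTranspose_mul]
    simp only [Matrix.mul_assoc, Matrix.star_eq_conjTranspose, hV]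
  -- Pythagoras for the unit vector `v i`: `‖E v i‖² = 1 - ‖(1 - E) v i‖²`.
  have hEV : ∀ i, (((E * V)ᴴ * (E * V)) i i).re ≤ 1 := by
    intro i
    have h1 := conjTranspose_mul_self_apply_self ((1 - E) * V) i
    have h2 : ((1 - E) * V)ᴴ * ((1 - E) * V) = 1 - (E * V)ᴴ * (E * V) := by
      simp only [Matrix.conjTranspose_mul, Matrix.conjTranspose_sub, Matrix.conjTranspose_one,
        hE.eq]
      have h3 : Vᴴ * E * (E * V) = Vᴴ * E * V := by
        rw [Matrix.mul_assoc, ← Matrix.mul_assoc E, hE2, Matrix.mul_assoc]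
      have h4 : (1 - E) * (1 - E) = 1 - E := by simp [mul_sub, sub_mul, hE2]
      rw [h3, Matrix.mul_assoc, ← Matrix.mul_assoc (1 - E), h4, Matrix.sub_mul, Matrix.mul_sub,
        Matrix.one_mul, hVV', Matrix.mul_assoc]
    have h5 : 0 ≤ ∑ k, ‖((1 - E) * V) k i‖ ^ 2 := by positivity
    rw [← h1, h2, Matrix.sub_apply, Matrix.one_apply_eq, Complex.sub_re, Complex.one_re] at h5
    linarith
  rw [htr, Matrix.trace, Complex.re_sum, traceNorm]
  refine Finset.sum_le_sum fun i _ => ?_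
  refine (Complex.re_le_norm _).trans ((norm_conjTranspose_mul_apply_self_le _ _ i).trans ?_)
  have hi : (((D * V)ᴴ * (D * V)) i i).re = hD.eigenvalues i := by
    rw [hspec, Matrix.diagonal_apply_eq]; rfl
  rw [hi]
  exact mul_le_of_le_one_left (Real.sqrt_nonneg _) (Real.sqrt_le_one.mpr (hEV i))

end Projection

/-! ### The projection onto the vectors fixed by an involution of the basis -/

section FixedProj

variable {X : Type*} [DecidableEq X]

/-- The orthogonal projection `(1 + U_σ) / 2` onto the vectors fixed by the involution `σ`. -/
noncomputable def fixedProj (σ : Equiv.Perm X) : Matrix X X ℂ :=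
  (1 / 2 : ℂ) • (1 + σ.permMatrix ℂ)

variable {σ : Equiv.Perm X}

theorem fixedProj_isHermitian (hσ : σ * σ = 1) : (fixedProj σ).IsHermitian := by
  have h : σ⁻¹ = σ := inv_eq_of_mul_eq_one_left hσ
  rw [Matrix.IsHermitian, fixedProj, Matrix.conjTranspose_smul, Matrix.conjTranspose_add,
    Matrix.conjTranspose_one, Matrix.conjTranspose_permMatrix, h]
  simp

variable [Fintype X]

theorem fixedProj_mul_self (hσ : σ * σ = 1) : fixedProj σ * fixedProj σ = fixedProj σ := by
  have h : σ.permMatrix ℂ * σ.permMatrix ℂ = 1 := by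
    rw [← Matrix.permMatrix_mul, hσ, Matrix.permMatrix_one]
  simp only [fixedProj, Matrix.smul_mul, Matrix.mul_smul, mul_add, add_mul, h, one_mul,
    mul_one]
  module

theorem trace_fixedProj_mul_ketbra (σ : Equiv.Perm X) (ψ : X → ℂ) :
    (fixedProj σ * ketbra ψ).trace = ∑ x, (1 / 2 : ℂ) * (ψ x + ψ (σ x)) * star (ψ x) := by
  rw [fixedProj, ketbra, Matrix.mul_vecMulVec, Matrix.trace_vecMulVec, Matrix.smul_mulVec,
    Matrix.add_mulVec, Matrix.one_mulVec, Matrix.permMatrix_mulVec]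
  simp [dotProduct]

end FixedProj

/-- Each of the `2 ^ M.card` terms factors over the copies and contributes the same `q ^ t`, so the
average does too. -/
theorem tensorPow_trace_mul_averageState {X Y : Type*} [Fintype X] (t : ℕ) (M : Finset Y)
    (ψ : Finset Y → X → ℂ) (P : Matrix X X ℂ) (q : ℂ)
    (h : ∀ A ⊆ M, (P * ketbra (ψ A)).trace = q) :
    (tensorPow t P * averageState t M ψ).trace = q ^ t := by
  have h2 : ∑ A ∈ M.powerset, (tensorPow t P * tensorPow t (ketbra (ψ A))).trace
      = (2 : ℂ) ^ M.card * q ^ t := by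
    rw [Finset.sum_congr rfl (g := fun _ => q ^ t) fun A hA => by
      rw [← tensorPow_mul, trace_tensorPow, h A (Finset.mem_powerset.mp hA)]]
    simp
  rw [averageState, Matrix.mul_smul, Matrix.trace_smul, Matrix.mul_sum, Matrix.trace_sum, h2,
    smul_eq_mul, inv_mul_cancel_left₀ (by positivity)]

/-- If the projection fixed by an involution accepts one family with certainty and the other with
probability `q`, then `t` copies separate their averages by `1 - q ^ t`. -/
theorem fixedProj_distinguishes {X Y : Type*} [Fintype X] [DecidableEq X] (t : ℕ) (M : Finset Y)
    (ψ₀ ψ₁ : Finset Y → X → ℂ) {σ : Equiv.Perm X} (hσ : σ * σ = 1) (q : ℝ)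
    (h₀ : ∀ A ⊆ M, (fixedProj σ * ketbra (ψ₀ A)).trace = 1)
    (h₁ : ∀ A ⊆ M, (fixedProj σ * ketbra (ψ₁ A)).trace = q) :
    IsEffect (tensorPow t (fixedProj σ)) ∧
    acceptProb (tensorPow t (fixedProj σ)) (averageState t M ψ₀) = 1 ∧
    acceptProb (tensorPow t (fixedProj σ)) (averageState t M ψ₁) = q ^ t ∧
    1 - q ^ t ≤ traceNorm (averageState t M ψ₀ - averageState t M ψ₁) := by
  have hH := tensorPow_isHermitian t (fixedProj_isHermitian hσ)
  have hI : tensorPow t (fixedProj σ) * tensorPow t (fixedProj σ) = tensorPow t (fixedProj σ) := by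
    rw [← tensorPow_mul, fixedProj_mul_self hσ]
  have e₀ : acceptProb (tensorPow t (fixedProj σ)) (averageState t M ψ₀) = 1 := by
    rw [acceptProb, tensorPow_trace_mul_averageState t M ψ₀ _ 1 h₀, one_pow, Complex.one_re]
  have e₁ : acceptProb (tensorPow t (fixedProj σ)) (averageState t M ψ₁) = q ^ t := by
    rw [acceptProb, tensorPow_trace_mul_averageState t M ψ₁ _ q h₁, ← Complex.ofReal_pow,
      Complex.ofReal_re]
  refine ⟨isEffect_of_isHermitian_of_mul_self hH hI, e₀, e₁, ?_⟩
  have h := re_trace_mul_le_traceNorm hH hI (averageState t M ψ₀ - averageState t M ψ₁)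
  rwa [Matrix.mul_sub, Matrix.trace_sub, Complex.sub_re, ← acceptProb, ← acceptProb, e₀, e₁] at h

/-! ### The involution that swaps the two strings of each pair -/

section PairSwap

variable {n : ℕ} {M : Finset (Cube n × Cube n)}

theorem mem_cover {x : Cube n} : x ∈ cover M ↔ ∃ p ∈ M, x = p.1 ∨ x = p.2 := by
  simp only [cover, Finset.mem_union, Finset.mem_image]
  constructor
  · rintro (⟨p, hp, rfl⟩ | ⟨p, hp, rfl⟩)
    exacts [⟨p, hp, .inl rfl⟩, ⟨p, hp, .inr rfl⟩]
  · rintro ⟨p, hp, rfl | rfl⟩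
    exacts [.inl ⟨p, hp, rfl⟩, .inr ⟨p, hp, rfl⟩]

theorem card_cover (hM : IsPairing M) : (cover M).card = 2 * M.card := by
  rw [cover, Finset.card_union_of_disjoint, Finset.card_image_of_injOn, Finset.card_image_of_injOn,
    two_mul]
  · exact fun p hp q hq h => hM.snd_inj p hp q hq h
  · exact fun p hp q hq h => hM.fst_inj p hp q hq h
  · rw [Finset.disjoint_left]
    intro x hx hx'
    obtain ⟨p, hp, rfl⟩ := Finset.mem_image.mp hx
    obtain ⟨q, hq, h⟩ := Finset.mem_image.mp hx'
    exact hM.fst_ne_snd p hp q hq h.symm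

open Classical in
/-- The map that exchanges `u` and `v` for each pair `(u, v)` in `M`. -/
noncomputable def swapFun (M : Finset (Cube n × Cube n)) (x : Cube n) : Cube n :=
  if h : ∃ p ∈ M, x = p.1 then h.choose.2 else if h : ∃ p ∈ M, x = p.2 then h.choose.1 else x

theorem swapFun_fst (hM : IsPairing M) {p : Cube n × Cube n} (hp : p ∈ M) :
    swapFun M p.1 = p.2 := by
  have h : ∃ q ∈ M, p.1 = q.1 := ⟨p, hp, rfl⟩
  rw [swapFun, dif_pos h, ← hM.fst_inj p hp _ h.choose_spec.1 h.choose_spec.2]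

theorem swapFun_snd (hM : IsPairing M) {p : Cube n × Cube n} (hp : p ∈ M) :
    swapFun M p.2 = p.1 := by
  have h : ∃ q ∈ M, p.2 = q.2 := ⟨p, hp, rfl⟩
  have h' : ¬ ∃ q ∈ M, p.2 = q.1 := fun ⟨q, hq, e⟩ => hM.fst_ne_snd q hq p hp e.symm
  rw [swapFun, dif_neg h', dif_pos h, ← hM.snd_inj p hp _ h.choose_spec.1 h.choose_spec.2]

theorem swapFun_of_notMem_cover {x : Cube n} (hx : x ∉ cover M) : swapFun M x = x := by
  rw [mem_cover] at hx
  rw [swapFun, dif_neg fun ⟨p, hp, e⟩ => hx ⟨p, hp, .inl e⟩,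
    dif_neg fun ⟨p, hp, e⟩ => hx ⟨p, hp, .inr e⟩]

theorem swapFun_involutive (hM : IsPairing M) : Function.Involutive (swapFun M) := by
  intro x
  by_cases hx : x ∈ cover M
  · obtain ⟨p, hp, rfl | rfl⟩ := mem_cover.mp hx
    · rw [swapFun_fst hM hp, swapFun_snd hM hp]
    · rw [swapFun_snd hM hp, swapFun_fst hM hp]
  · rw [swapFun_of_notMem_cover hx, swapFun_of_notMem_cover hx]

variable {g : {x : Cube n // x ∉ cover M} → Bool} {A : Finset (Cube n × Cube n)}

theorem twin0_fst (hM : IsPairing M) (hA : A ⊆ M) {p : Cube n × Cube n} (hp : p ∈ M) :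
    twin0 M g A p.1 = decide (p ∈ A) := by
  rw [twin0, dif_pos (mem_cover.mpr ⟨p, hp, .inl rfl⟩), decide_eq_decide]
  constructor
  · rintro ⟨q, hq, e | e⟩
    · rwa [hM.fst_inj p hp q (hA hq) e]
    · exact absurd e (hM.fst_ne_snd p hp q (hA hq))
  · exact fun h => ⟨p, h, .inl rfl⟩

theorem twin0_snd (hM : IsPairing M) (hA : A ⊆ M) {p : Cube n × Cube n} (hp : p ∈ M) :
    twin0 M g A p.2 = decide (p ∈ A) := by
  rw [twin0, dif_pos (mem_cover.mpr ⟨p, hp, .inr rfl⟩), decide_eq_decide]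
  constructor
  · rintro ⟨q, hq, e | e⟩
    · exact absurd e.symm (hM.fst_ne_snd q (hA hq) p hp)
    · rwa [hM.snd_inj p hp q (hA hq) e]
  · exact fun h => ⟨p, h, .inr rfl⟩

theorem twin1_fst (hM : IsPairing M) (hA : A ⊆ M) {p : Cube n × Cube n} (hp : p ∈ M) :
    twin1 M g A p.1 = decide (p ∈ A) := by
  rw [twin1, dif_pos (mem_cover.mpr ⟨p, hp, .inl rfl⟩), decide_eq_decide]
  constructor
  · rintro (⟨q, hq, e⟩ | ⟨q, hq, e⟩)
    · rwa [hM.fst_inj p hp q (hA hq) e]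
    · exact absurd e (hM.fst_ne_snd p hp q (Finset.mem_sdiff.mp hq).1)
  · exact fun h => .inl ⟨p, h, rfl⟩

theorem twin1_snd (hM : IsPairing M) (hA : A ⊆ M) {p : Cube n × Cube n} (hp : p ∈ M) :
    twin1 M g A p.2 = decide (p ∉ A) := by
  rw [twin1, dif_pos (mem_cover.mpr ⟨p, hp, .inr rfl⟩), decide_eq_decide]
  constructor
  · rintro (⟨q, hq, e⟩ | ⟨q, hq, e⟩)
    · exact absurd e.symm (hM.fst_ne_snd q (hA hq) p hp)
    · obtain ⟨hqM, hqA⟩ := Finset.mem_sdiff.mp hq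
      rwa [hM.snd_inj p hp q hqM e]
  · exact fun h => .inr ⟨p, Finset.mem_sdiff.mpr ⟨hp, h⟩, rfl⟩

theorem twin0_swapFun (hM : IsPairing M) (hA : A ⊆ M) (x : Cube n) :
    twin0 M g A (swapFun M x) = twin0 M g A x := by
  by_cases hx : x ∈ cover M
  · obtain ⟨p, hp, rfl | rfl⟩ := mem_cover.mp hx
    · rw [swapFun_fst hM hp, twin0_fst hM hA hp, twin0_snd hM hA hp]
    · rw [swapFun_snd hM hp, twin0_fst hM hA hp, twin0_snd hM hA hp]
  · rw [swapFun_of_notMem_cover hx]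

theorem twin1_swapFun_eq_iff (hM : IsPairing M) (hA : A ⊆ M) (x : Cube n) :
    twin1 M g A (swapFun M x) = twin1 M g A x ↔ x ∉ cover M := by
  by_cases hx : x ∈ cover M
  · refine iff_of_false ?_ (not_not.mpr hx)
    obtain ⟨p, hp, rfl | rfl⟩ := mem_cover.mp hx
    · rw [swapFun_fst hM hp, twin1_fst hM hA hp, twin1_snd hM hA hp]; simp
    · rw [swapFun_snd hM hp, twin1_fst hM hA hp, twin1_snd hM hA hp]; simp
  · rw [swapFun_of_notMem_cover hx]; simp [hx]

end PairSwap

/-! ### Acceptance probabilities for phase and function states -/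

section Acceptance

variable {n : ℕ}

theorem inv_sqrt_two_pow_mul_self (n : ℕ) :
    ((Real.sqrt (2 ^ n) : ℝ) : ℂ)⁻¹ * ((Real.sqrt (2 ^ n) : ℝ) : ℂ)⁻¹ = ((2 : ℂ) ^ n)⁻¹ := by
  rw [← mul_inv, ← Complex.ofReal_mul, Real.mul_self_sqrt (by positivity)]
  simp

theorem sum_ite_one_sub (S : Finset (Cube n)) (a : ℝ) :
    ∑ x, ((2 : ℂ) ^ n)⁻¹ * (if x ∈ S then 1 - (a : ℂ) else 1) =
      ((1 - a * (S.card / 2 ^ n) : ℝ) : ℂ) := by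
  have h : ∀ x : Cube n, (if x ∈ S then 1 - (a : ℂ) else 1) = 1 - if x ∈ S then (a : ℂ) else 0 := by
    intro x; split_ifs <;> simp
  simp only [h]
  rw [← Finset.mul_sum, Finset.sum_sub_distrib, Finset.sum_ite_mem, Finset.univ_inter]
  simp only [Finset.sum_const, Finset.card_univ, Fintype.card_fun, Fintype.card_bool,
    Fintype.card_fin, nsmul_eq_mul]
  push_cast
  field_simp

/-- At `x ∈ S` the amplitudes at `x` and `σ x` have opposite signs and cancel, so each point of `S`
loses its whole weight `2 ^ (-n)`. -/
theorem trace_fixedProj_mul_phaseState (σ : Equiv.Perm (Cube n)) (f : Cube n → Bool)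
    (S : Finset (Cube n)) (hS : ∀ x, f (σ x) = f x ↔ x ∉ S) :
    (fixedProj σ * ketbra (phaseState f)).trace = ((1 - S.card / 2 ^ n : ℝ) : ℂ) := by
  have h := sum_ite_one_sub S 1
  rw [one_mul] at h
  rw [trace_fixedProj_mul_ketbra, ← h]
  refine Finset.sum_congr rfl fun x _ => ?_
  rw [← inv_sqrt_two_pow_mul_self]
  have hx := hS x
  simp only [phaseState]
  by_cases hxS : x ∈ S <;> simp only [hxS, not_true_eq_false, not_false_eq_true, iff_true,
    iff_false, if_true, if_false] at hx ⊢ <;> revert hx <;> cases f (σ x) <;> cases f x <;> simp <;>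
    ring

/-- At `x ∈ S` the basis vector `(x, f x)` is sent outside the support of the state. The cross term
vanishes rather than being negative, so only half the weight is lost. -/
theorem trace_fixedProj_mul_functionState (σ : Equiv.Perm (Cube n)) (f : Cube n → Bool)
    (S : Finset (Cube n)) (hS : ∀ x, f (σ x) = f x ↔ x ∉ S) :
    (fixedProj (σ.prodCongr (Equiv.refl Bool)) * ketbra (functionState f)).trace =
      ((1 - 1 / 2 * (S.card / 2 ^ n) : ℝ) : ℂ) := by
  rw [trace_fixedProj_mul_ketbra, ← sum_ite_one_sub S (1 / 2), Fintype.sum_prod_type]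
  refine Finset.sum_congr rfl fun x _ => ?_
  rw [← inv_sqrt_two_pow_mul_self]
  have hx := hS x
  simp only [functionState, Fintype.sum_bool, Equiv.prodCongr_apply, Prod.map]
  by_cases hxS : x ∈ S <;> simp only [hxS, not_true_eq_false, not_false_eq_true, iff_true,
    iff_false, if_true, if_false] at hx ⊢ <;> revert hx <;> cases f (σ x) <;> cases f x <;> simp <;>
    ring

end Acceptance

/-! ### Distinguishing the twin ensembles -/

section Twins

variable {n : ℕ} {M : Finset (Cube n × Cube n)} {ε : ℝ}

/-- Keeps `1 - 2 * ε` and `1 - ε` nonnegative, as needed to raise `1 - a ≤ exp (-a)` to the power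
`t`. -/
theorem two_mul_le_one_of_isPairing (hM : IsPairing M) (hε : ε * 2 ^ n = (M.card : ℝ)) :
    2 * ε ≤ 1 := by
  have h : ((cover M).card : ℝ) ≤ 2 ^ n := by
    have := Finset.card_le_univ (cover M)
    simp only [Fintype.card_fun, Fintype.card_bool, Fintype.card_fin] at this
    exact_mod_cast this
  rw [card_cover hM, Nat.cast_mul, ← hε] at h
  have h2 : (0 : ℝ) < 2 ^ n := by positivity
  push_cast at h
  nlinarith

theorem card_cover_div (hM : IsPairing M) (hε : ε * 2 ^ n = (M.card : ℝ)) :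
    ((cover M).card : ℝ) / 2 ^ n = 2 * ε := by
  rw [card_cover hM, Nat.cast_mul, ← hε]
  push_cast
  field_simp

theorem exists_phaseState_trace (hM : IsPairing M) (hε : ε * 2 ^ n = (M.card : ℝ))
    (g : {x : Cube n // x ∉ cover M} → Bool) :
    ∃ σ : Equiv.Perm (Cube n), σ * σ = 1 ∧
      (∀ A ⊆ M, (fixedProj σ * ketbra (phaseState (twin0 M g A))).trace = 1) ∧
      ∀ A ⊆ M, (fixedProj σ * ketbra (phaseState (twin1 M g A))).trace = ((1 - 2 * ε : ℝ) : ℂ) := by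
  refine ⟨(swapFun_involutive hM).toPerm, Equiv.ext (swapFun_involutive hM), fun A hA => ?_,
    fun A hA => ?_⟩
  · rw [trace_fixedProj_mul_phaseState _ _ ∅ fun x => by simpa using twin0_swapFun hM hA x]
    simp
  · rw [trace_fixedProj_mul_phaseState _ _ (cover M) (twin1_swapFun_eq_iff hM hA),
      card_cover_div hM hε]

theorem exists_functionState_trace (hM : IsPairing M) (hε : ε * 2 ^ n = (M.card : ℝ))
    (g : {x : Cube n // x ∉ cover M} → Bool) :
    ∃ σ : Equiv.Perm (Cube n × Bool), σ * σ = 1 ∧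
      (∀ A ⊆ M, (fixedProj σ * ketbra (functionState (twin0 M g A))).trace = 1) ∧
      ∀ A ⊆ M, (fixedProj σ * ketbra (functionState (twin1 M g A))).trace = ((1 - ε : ℝ) : ℂ) := by
  refine ⟨(swapFun_involutive hM).toPerm.prodCongr (Equiv.refl Bool),
    Equiv.ext fun z => Prod.ext (swapFun_involutive hM z.1) rfl, fun A hA => ?_, fun A hA => ?_⟩
  · rw [trace_fixedProj_mul_functionState _ _ ∅ fun x => by simpa using twin0_swapFun hM hA x]
    simp
  · rw [trace_fixedProj_mul_functionState _ _ (cover M) (twin1_swapFun_eq_iff hM hA),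
      card_cover_div hM hε, one_div, inv_mul_cancel_left₀ two_ne_zero]

theorem one_sub_pow_le_exp_neg {a c : ℝ} (ha : a ≤ 1) (t : ℕ) (h : c ≤ a * t) :
    (1 - a) ^ t ≤ Real.exp (-c) := by
  calc (1 - a) ^ t ≤ Real.exp (-a) ^ t :=
        pow_le_pow_left₀ (sub_nonneg.mpr ha) (Real.one_sub_le_exp_neg a) t
    _ = Real.exp (-(a * t)) := by rw [← Real.exp_nat_mul]; ring_nf
    _ ≤ Real.exp (-c) := Real.exp_le_exp.mpr (neg_le_neg h)

end Twins

theorem mainTheorem4 :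
    (∀ c : ℝ, 0 < c → ∃ δ : ℝ, 0 < δ ∧
      ∀ (n : ℕ) (M : Finset (Cube n × Cube n)), IsPairing M →
      ∀ (g : {x : Cube n // x ∉ cover M} → Bool) (ε : ℝ), 0 < ε → ε * 2 ^ n = (M.card : ℝ) →
      ∀ t : ℕ, c / ε ≤ (t : ℝ) →
        δ ≤ traceNorm (averageState t M (fun A => phaseState (twin0 M g A)) -
              averageState t M (fun A => phaseState (twin1 M g A))) ∧
        δ ≤ traceNorm (averageState t M (fun A => functionState (twin0 M g A)) -
              averageState t M (fun A => functionState (twin1 M g A)))) ∧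
    (∃ C : ℝ, 0 < C ∧
      ∀ (n : ℕ) (M : Finset (Cube n × Cube n)), IsPairing M →
      ∀ (g : {x : Cube n // x ∉ cover M} → Bool) (ε : ℝ), 0 < ε → ε * 2 ^ n = (M.card : ℝ) →
      ∀ t : ℕ, C / ε ≤ (t : ℝ) →
        ∃ E : Matrix (Fin t → Cube n × Bool) (Fin t → Cube n × Bool) ℂ, IsEffect E ∧
          2 / 3 ≤ acceptProb E (averageState t M (fun A => functionState (twin0 M g A))) ∧
          acceptProb E (averageState t M (fun A => functionState (twin1 M g A))) ≤ 1 / 3) := by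
  -- The constant `2` serves as `C` because `exp 2 ≥ 2 + 1` gives `exp (-2) ≤ 1 / 3`.
  refine ⟨fun c hc => ⟨1 - Real.exp (-c), by simpa using hc, ?_⟩,
    2, two_pos, ?_⟩
  · intro n M hM g ε hε hεn t ht
    have ht' : c ≤ ε * t := by rwa [div_le_iff₀' hε] at ht
    have h2ε := two_mul_le_one_of_isPairing hM hεn
    constructor
    · obtain ⟨σ, hσ, h₀, h₁⟩ := exists_phaseState_trace hM hεn g
      refine le_trans ?_ (fixedProj_distinguishes t M _ _ hσ _ h₀ h₁).2.2.2
      exact sub_le_sub_left (one_sub_pow_le_exp_neg h2ε t (by linarith)) 1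
    · obtain ⟨σ, hσ, h₀, h₁⟩ := exists_functionState_trace hM hεn g
      refine le_trans ?_ (fixedProj_distinguishes t M _ _ hσ _ h₀ h₁).2.2.2
      exact sub_le_sub_left (one_sub_pow_le_exp_neg (by linarith) t ht') 1
  · intro n M hM g ε hε hεn t ht
    have ht' : 2 ≤ ε * t := by rwa [div_le_iff₀' hε] at ht
    have h2ε := two_mul_le_one_of_isPairing hM hεn
    obtain ⟨σ, hσ, h₀, h₁⟩ := exists_functionState_trace hM hεn g
    obtain ⟨hE, e₀, e₁, -⟩ := fixedProj_distinguishes t M _ _ hσ _ h₀ h₁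
    refine ⟨_, hE, by rw [e₀]; norm_num, ?_⟩
    rw [e₁]
    refine (one_sub_pow_le_exp_neg (by linarith) t ht').trans ?_
    rw [Real.exp_neg, one_div]
    exact inv_anti₀ (by norm_num) (by linarith [Real.add_one_le_exp (2 : ℝ)])
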